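/- Consider the $T$-round game between a randomized player with action set $\mathcal{A}=\{1,2\}$ and a deterministic adaptive adversary who fixes in advance history-dependent loss functions $f_t:\mathcal{A}^t\to\mathbb{R}$, $t=1,\dots,T$. Under full-information feedback, a player strategy chooses, on each round $t$, a probability distribution on $\mathcal{A}$ as a function of the past actions $X_1,\dots,X_{t-1}$ and of the observed values $f_s(X_{1:s-1},x)$ for all $s<t$ and all $x\in\mathcal{A}$, and draws $X_t$ from it. The (policy) regret is $$R_T=\sum_{t=1}^T f_t(X_{1:t})-\min_{x\in\mathcal{A}}\sum_{t=1}^T f_t(x,\dots,x).$$ Theorem. For every player strategy that relies on full-information feedback and every number of rounds $T\ge 2$, there exist loss functions $f_1,\dots,f_T$ such that (i) (memory of size $m=2$) for all $1\le t\le T$, $f_t(x_{1:t})$ depends only on the actions $x_s$ with $\max(1,t-2)\le s\le t$; (ii) (range bounded by $C=2$) $|f_t(x_{1:t})-f_t(x'_{1:t})|\le 2$ for all $1\le t\le T$ and all $x_{1:t},x'_{1:t}\in\mathcal{A}^t$; (iii) (drift bounded by $D_t=\sqrt{3\log t+18}$) $|f_t(x_{1:t})-f_{t+1}(x_{1:t},x_t)|\le\sqrt{3\log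 t+18}$ for all $1\le t\le T-1$ and all $x_{1:t}\in\mathcal{A}^t$; and the expected regret of the player (over his own randomization) satisfies $$\mathbb{E}[R_T]\ \ge\ \tfrac{1}{40}(T-1)^{2/3}.$$ -/

import Mathlib

namespace RepeatedGame

/-- A deterministic adversary: a sequence of history-dependent loss functions. The function
`f t` is the loss function of round `t` (rounds are numbered `1, 2, …`); its argument
`x : Fin t → A` is the sequence of actions of rounds `1, …, t`, where `x i` is the action of
round `i + 1`. The value `f 0` plays no role. -/
abbrev LossSeq (A : Type*) := (t : ℕ) → (Fin t → A) → ℝ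

/-- The first `s` entries of a sequence of `t` actions, for `s ≤ t`. -/
def takeFirst {A : Type*} {s t : ℕ} (h : s ≤ t) (x : Fin t → A) : Fin s → A :=
  fun i => x (Fin.castLE h i)

/-- The sequence of actions `x` followed by the further action `a`. -/
def append {A : Type*} {t : ℕ} (x : Fin t → A) (a : A) : Fin (t + 1) → A :=
  Fin.snoc (α := fun _ => A) x a

/-- The loss functions of rounds `1, …, T` have a memory of size `m`: the loss of round `t`
depends only on the actions of rounds `t - m, …, t`. -/
def HasMemory {A : Type*} (f : LossSeq A) (T m : ℕ) : Prop :=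
  ∀ t : ℕ, 1 ≤ t → t ≤ T → ∀ x x' : Fin t → A,
    (∀ i : Fin t, t ≤ (i : ℕ) + 1 + m → x i = x' i) → f t x = f t x'

/-- On each of the rounds `1, …, T` the losses lie in an interval of length `C`. -/
def HasRange {A : Type*} (f : LossSeq A) (T : ℕ) (C : ℝ) : Prop :=
  ∀ t : ℕ, 1 ≤ t → t ≤ T → ∀ x x' : Fin t → A, |f t x - f t x'| ≤ C

/-- The drift from round `t` to round `t + 1` is at most `D t`, for every `t = s + 1` with
`1 ≤ t < t + 1 ≤ T`: repeating the last action changes the loss by at most `D t`. -/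
def HasDrift {A : Type*} (f : LossSeq A) (T : ℕ) (D : ℕ → ℝ) : Prop :=
  ∀ s : ℕ, s + 2 ≤ T → ∀ x : Fin (s + 1) → A,
    |f (s + 1) x - f (s + 2) (append x (x (Fin.last s)))| ≤ D (s + 1)

/-- The full-information feedback received during the first `t` rounds, if the actions played
were `x`: for the round with index `s` (round `s + 1`), the loss that each action `a` would have
incurred on that round, given the actions actually played on the earlier rounds. -/
def feedback {A : Type*} (f : LossSeq A) {t : ℕ} (x : Fin t → A) : Fin t → A → ℝ :=
  fun s a => f ((s : ℕ) + 1) (append (takeFirst s.isLt.le x) a)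

/-- A randomized player strategy under full-information feedback: after `t` rounds, the player
chooses a probability distribution for the action of round `t + 1`, based on the actions played
so far and on the feedback (one loss value for every action and every past round). -/
abbrev FullInfoStrategy (A : Type*) :=
  (t : ℕ) → (Fin t → A) → (Fin t → A → ℝ) → PMF A

/-- The joint law of the actions of rounds `1, …, t` when the strategy `σ` plays against `f`. -/
noncomputable def actionLaw {A : Type*} (σ : FullInfoStrategy A) (f : LossSeq A) :
    (t : ℕ) → PMF (Fin t → A)
  | 0 => PMF.pure Fin.elim0
  | t + 1 => (actionLaw σ f t).bind fun x => (σ t x (feedback f x)).map (append x)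

/-- The cumulative loss on rounds `1, …, T` of the action sequence `x`. -/
def cumulativeLoss {A : Type*} (f : LossSeq A) {T : ℕ} (x : Fin T → A) : ℝ :=
  ∑ t : Fin T, f ((t : ℕ) + 1) (takeFirst (Nat.succ_le_of_lt t.isLt) x)

/-- The (policy) regret `R_T` of the action sequence `x`: its cumulative loss minus the cumulative
loss of the best constant action sequence. -/
noncomputable def regret {A : Type*} [Fintype A] [Nonempty A] (f : LossSeq A) {T : ℕ}
    (x : Fin T → A) : ℝ :=
  cumulativeLoss f x -
    Finset.univ.inf' Finset.univ_nonempty fun a : A => cumulativeLoss f (fun _ : Fin T => a)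

/-- The expected regret `E[R_T]` of the strategy `σ` against `f`. -/
noncomputable def expectedRegret {A : Type*} [Fintype A] [Nonempty A]
    (σ : FullInfoStrategy A) (f : LossSeq A) (T : ℕ) : ℝ :=
  ∑ x : Fin T → A, (actionLaw σ f T x).toReal * regret f x

end RepeatedGame

/-!
The adversary hides a two-armed bandit problem with switching costs in the full-information game.
With `n = T - 1`, round `s + 2` charges the bandit loss of the action of round `s + 1`, plus one if
that action was a switch. The loss does not depend on the current action, so the values for both
actions reveal only the bandit loss of an action that was already played (`feedback_lossSeq`).

In the bandit problem both actions follow a common random walk, except for a gap `± δ` whose sign is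
a hidden parameter `Z`. In terms of the increments of the observed loss, the value of `Z` only
matters at switches: there the noise is translated by `Z` or `-Z` lattice steps
(`roundLoss_eq_shifted`). A player that does not switch learns nothing, and one that switches pays.
Quantitatively, one minus the Hellinger affinity of the laws of the observed history for `Z = 0` and
`Z = 1` is at most `1 - cos (π / N)` times the average expected number of switches
(`one_sub_affinity_le`, `affinity_stepLaw`). By Le Cam's two-point method (`two_point_bound`) the
player then plays the worse action a constant fraction of the time in one of the two worlds, unless
there are so many switches that the switches alone cost as much (`two_world_bound`).

A Gaussian random walk would serve, but the noise with probabilities proportional to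
`sin² (π j / N)` on `0, …, N` has the same quadratic information for small gaps and bounded
increments, and makes all expectations finite sums. With `δ = 1 / N` and `N` about `8 n ^ (1/3)` the
drift is at most `4`, below the square root of `18`, and the regret is of order
`δ n`, that is `n ^ (2/3)`. Since the regret bound holds on average over the noise and `Z`, some
fixed choice attains it (`exists_noise`).
-/

namespace RepeatedGame

open Finset

/-! ### Laws of sequentially generated histories and their Hellinger affinity -/

section Chain

variable {Y : Type*}

/-- The law of the history of the first `t` steps, as a function on histories, when step `t + 1`
is drawn from `K t h` given the history `h` of the first `t` steps. -/
noncomputable def chainLaw (K : (t : ℕ) → (Fin t → Y) → Y → ℝ) : (t : ℕ) → (Fin t → Y) → ℝ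
  | 0, _ => 1
  | t + 1, h => chainLaw K t (Fin.init h) * K t (Fin.init h) (h (Fin.last t))

/-- The total cost along a history, if step `y` costs `w t h y` after the history `h`. -/
noncomputable def chainCost (w : (t : ℕ) → (Fin t → Y) → Y → ℝ) : (t : ℕ) → (Fin t → Y) → ℝ
  | 0, _ => 0
  | t + 1, h => chainCost w t (Fin.init h) + w t (Fin.init h) (h (Fin.last t))

theorem chainLaw_nonneg {K : (t : ℕ) → (Fin t → Y) → Y → ℝ} (hK : ∀ t h y, 0 ≤ K t h y) :
    ∀ t h, 0 ≤ chainLaw K t h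
  | 0, _ => zero_le_one
  | t + 1, _ => mul_nonneg (chainLaw_nonneg hK t _) (hK _ _ _)

variable [Fintype Y]

theorem sum_snoc (t : ℕ) (F : (Fin (t + 1) → Y) → ℝ) :
    ∑ h, F h = ∑ h : Fin t → Y, ∑ y, F (Fin.snoc (α := fun _ => Y) h y) := by
  rw [← (Fin.snocEquiv fun _ => Y).sum_comp, Fintype.sum_prod_type_right]
  rfl

theorem sum_chainLaw {K : (t : ℕ) → (Fin t → Y) → Y → ℝ} (h1 : ∀ t h, ∑ y, K t h y = 1) (t : ℕ) :
    ∑ h, chainLaw K t h = 1 := by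
  induction t with
  | zero => simp [chainLaw]
  | succ t ih =>
    rw [sum_snoc]
    simp only [chainLaw, Fin.init_snoc, Fin.snoc_last, ← Finset.mul_sum, h1, mul_one, ih]

theorem sum_chainLaw_mul_chainCost {K w : (t : ℕ) → (Fin t → Y) → Y → ℝ}
    {r : (t : ℕ) → (Fin t → Y) → ℝ} (h1 : ∀ t h, ∑ y, K t h y = 1)
    (hr : ∀ t h, ∑ y, K t h y * w t h y = r t h) (t : ℕ) :
    ∑ h, chainLaw K (t + 1) h * chainCost w (t + 1) h
      = ∑ h, chainLaw K t h * chainCost w t h + ∑ h, chainLaw K t h * r t h := by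
  rw [sum_snoc, ← Finset.sum_add_distrib]
  refine Finset.sum_congr rfl fun h _ => ?_
  simp only [chainLaw, chainCost, Fin.init_snoc, Fin.snoc_last, mul_add, Finset.sum_add_distrib]
  rw [← hr t h, Finset.mul_sum, ← Finset.sum_mul, ← Finset.mul_sum, h1]
  simp only [mul_one, mul_assoc]

/-- Two sequentially generated laws stay close in Hellinger distance if their conditional laws
agree except on steps that incur a cost: one minus the affinity is at most a constant times the
expected cost, averaged over the two laws. The expected cost of a step under the
geometric mean of the two laws is bounded by the average of the expected costs under each. -/
theorem one_sub_affinity_le {K₀ K₁ w : (t : ℕ) → (Fin t → Y) → Y → ℝ}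
    {r : (t : ℕ) → (Fin t → Y) → ℝ} {c : ℝ} (hc : 0 ≤ c)
    (hK₀ : ∀ t h y, 0 ≤ K₀ t h y) (hK₁ : ∀ t h y, 0 ≤ K₁ t h y)
    (h₀ : ∀ t h, ∑ y, K₀ t h y = 1) (h₁ : ∀ t h, ∑ y, K₁ t h y = 1)
    (hr : ∀ t h, 0 ≤ r t h)
    (hr₀ : ∀ t h, ∑ y, K₀ t h y * w t h y = r t h)
    (hr₁ : ∀ t h, ∑ y, K₁ t h y * w t h y = r t h)
    (haff : ∀ t h, 1 - c * r t h ≤ ∑ y, √(K₀ t h y * K₁ t h y)) (t : ℕ) :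
    1 - ∑ h, √(chainLaw K₀ t h * chainLaw K₁ t h)
      ≤ c * ((∑ h, chainLaw K₀ t h * chainCost w t h
        + ∑ h, chainLaw K₁ t h * chainCost w t h) / 2) := by
  induction t with
  | zero => simp [chainLaw, chainCost]
  | succ t ih =>
    have hn₀ := chainLaw_nonneg hK₀ t
    have hn₁ := chainLaw_nonneg hK₁ t
    have hstep : ∑ h, √(chainLaw K₀ t h * chainLaw K₁ t h)
        - c * ((∑ h, chainLaw K₀ t h * r t h + ∑ h, chainLaw K₁ t h * r t h) / 2)
        ≤ ∑ h, √(chainLaw K₀ (t + 1) h * chainLaw K₁ (t + 1) h) := by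
      rw [sum_snoc, ← Finset.sum_add_distrib, Finset.sum_div, Finset.mul_sum,
        ← Finset.sum_sub_distrib]
      refine Finset.sum_le_sum fun h _ => ?_
      simp only [chainLaw, Fin.init_snoc, Fin.snoc_last]
      have hfac : ∀ y, √(chainLaw K₀ t h * K₀ t h y * (chainLaw K₁ t h * K₁ t h y))
          = √(chainLaw K₀ t h * chainLaw K₁ t h) * √(K₀ t h y * K₁ t h y) := fun y => by
        rw [← Real.sqrt_mul (mul_nonneg (hn₀ h) (hn₁ h))]
        congr 1
        ring
      simp only [hfac, ← Finset.mul_sum]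
      set a := chainLaw K₀ t h
      set b := chainLaw K₁ t h
      have hab : √(a * b) ≤ (a + b) / 2 := by
        refine Real.sqrt_le_iff.2 ⟨by have := hn₀ h; have := hn₁ h; positivity, ?_⟩
        nlinarith [sq_nonneg (a - b)]
      have h1 := mul_le_mul_of_nonneg_left (haff t h) (Real.sqrt_nonneg (a * b))
      have h2 := mul_le_mul_of_nonneg_right hab (mul_nonneg hc (hr t h))
      nlinarith
    rw [sum_chainLaw_mul_chainCost h₀ hr₀, sum_chainLaw_mul_chainCost h₁ hr₁]
    linarith

end Chain

/-- A lower bound on the minimum of two numbers through their geometric mean: for `p ≤ q` the gap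
is `(5 √p - 3 √q) ^ 2 / 16`. -/
theorem le_min_of_sqrt {p q : ℝ} (hp : 0 ≤ p) (hq : 0 ≤ q) :
    15 / 8 * √(p * q) - 9 / 16 * (p + q) ≤ min p q := by
  rw [Real.sqrt_mul hp]
  have h1 := Real.sq_sqrt hp
  have h2 := Real.sq_sqrt hq
  rw [le_min_iff]
  constructor
  · nlinarith [sq_nonneg (5 * √p - 3 * √q)]
  · nlinarith [sq_nonneg (5 * √q - 3 * √p)]

/-- Le Cam's two-point bound: the expectation of `φ` under one law plus that of `n - φ` under another
is bounded below by `n` times an affine function of the affinity of the two laws, which is positive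
if the affinity is close to one. -/
theorem two_point_bound {H : Type*} [Fintype H] {P Q φ : H → ℝ} {n : ℝ}
    (hP : ∀ h, 0 ≤ P h) (hQ : ∀ h, 0 ≤ Q h) (hP1 : ∑ h, P h = 1) (hQ1 : ∑ h, Q h = 1)
    (h0 : ∀ h, 0 ≤ φ h) (hn : ∀ h, φ h ≤ n) (hn0 : 0 ≤ n) :
    n * (3 / 4 - 15 / 8 * (1 - ∑ h, √(P h * Q h)))
      ≤ ∑ h, P h * φ h + ∑ h, Q h * (n - φ h) := by
  have key : ∀ h, n * (15 / 8 * √(P h * Q h) - 9 / 16 * (P h + Q h))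
      ≤ P h * φ h + Q h * (n - φ h) := fun h => by
    have h1 := mul_le_mul_of_nonneg_left (le_min_of_sqrt (hP h) (hQ h)) hn0
    have h2 := mul_le_mul_of_nonneg_right (min_le_left (P h) (Q h)) (h0 h)
    have h3 := mul_le_mul_of_nonneg_right (min_le_right (P h) (Q h)) (sub_nonneg.2 (hn h))
    linarith
  have hsum := Finset.sum_le_sum fun h (_ : h ∈ Finset.univ) => key h
  rw [← Finset.mul_sum, Finset.sum_sub_distrib, ← Finset.mul_sum, ← Finset.mul_sum,
    Finset.sum_add_distrib, Finset.sum_add_distrib, hP1, hQ1] at hsum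
  linarith

/-! ### The lattice noise -/

/-- Half a period of the sine, sampled at the integers `0, …, N` and extended by zero. -/
noncomputable def sineBump (N : ℕ) (j : ℤ) : ℝ :=
  if 0 ≤ j ∧ j ≤ N then Real.sin (j * (Real.pi / N)) else 0

/-- The normalising constant of `noise`. -/
noncomputable def noiseMass (N : ℕ) : ℝ := ∑ d : Fin (N + 1), sineBump N (d : ℕ) ^ 2

/-- The probability mass function on the integers that is proportional to the squared sine on
`0, …, N`. Its square root is an eigenvector of the discrete Laplacian, so that the affinity between
the noise and its unit translate is exactly the cosine of `π / N`. -/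
noncomputable def noise (N : ℕ) (j : ℤ) : ℝ := sineBump N j ^ 2 / noiseMass N

theorem sum_fin_eq_tsum {N : ℕ} {g : ℤ → ℝ} (hg : ∀ j, g j ≠ 0 → 0 ≤ j ∧ j ≤ N) :
    ∑ d : Fin (N + 1), g (d : ℕ) = ∑' j, g j := by
  rw [← tsum_fintype (L := .unconditional _)]
  refine Function.Injective.tsum_eq (g := fun d : Fin (N + 1) => ((d : ℕ) : ℤ)) ?_ ?_
  · intro a b hab
    exact Fin.ext (by simpa using hab)
  · intro j hj
    obtain ⟨h0, h1⟩ := hg j hj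
    exact ⟨⟨j.toNat, by omega⟩, by simp [h0]⟩

/-- A change of variables by translation in a sum over the lattice cube `{0, …, N} ^ n`, for a
function that is supported in the cube and in its translate. -/
theorem sum_cube_translate {N n : ℕ} {H : (Fin n → ℤ) → ℝ} {s : Fin n → ℤ}
    (h1 : ∀ k, H k ≠ 0 → ∀ i, 0 ≤ k i ∧ k i ≤ N)
    (h2 : ∀ k, H k ≠ 0 → ∀ i, 0 ≤ k i + s i ∧ k i + s i ≤ N) :
    ∑ k : Fin n → Fin (N + 1), H (fun i => ((k i : ℕ) : ℤ))
      = ∑ d : Fin n → Fin (N + 1), H (fun i => ((d i : ℕ) : ℤ) - s i) := by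
  have key : ∀ G : (Fin n → ℤ) → ℝ, (∀ k, G k ≠ 0 → ∀ i, 0 ≤ k i ∧ k i ≤ N) →
      ∑ k : Fin n → Fin (N + 1), G (fun i => ((k i : ℕ) : ℤ)) = ∑' k, G k := by
    intro G hG
    rw [← tsum_fintype (L := .unconditional _)]
    refine Function.Injective.tsum_eq
      (g := fun (k : Fin n → Fin (N + 1)) (i : Fin n) => ((k i : ℕ) : ℤ)) ?_ ?_
    · intro a b hab
      funext i
      exact Fin.ext (by simpa using congrFun hab i)
    · intro k hk
      have h := hG k hk
      exact ⟨fun i => ⟨(k i).toNat, by have := h i; omega⟩, by funext i; simp [(h i).1]⟩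
  rw [key H h1, key (fun d => H (fun i => d i - s i)), ← (Equiv.subRight s).tsum_eq H]
  · rfl
  · intro k hk i
    simpa using h2 _ hk i

section Noise

variable {N : ℕ}

theorem sineBump_nonneg (j : ℤ) : 0 ≤ sineBump N j := by
  unfold sineBump
  split_ifs with h
  · have h0 : (0 : ℝ) ≤ j := by exact_mod_cast h.1
    have h1 : (j : ℝ) ≤ N := by exact_mod_cast h.2
    refine Real.sin_nonneg_of_nonneg_of_le_pi (by positivity) ?_
    rcases Nat.eq_zero_or_pos N with rfl | hN
    · simp [Real.pi_pos.le]
    · have hN' : (0 : ℝ) < N := by exact_mod_cast hN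
      rw [← mul_div_assoc, div_le_iff₀ hN']
      nlinarith [Real.pi_pos]
  · exact le_rfl

theorem sineBump_eq_zero (hN : 0 < N) {j : ℤ} (h : j ≤ 0 ∨ N ≤ j) : sineBump N j = 0 := by
  have hN' : (N : ℝ) ≠ 0 := by exact_mod_cast hN.ne'
  unfold sineBump
  split_ifs with hj
  · rcases h with h | h
    · obtain rfl : j = 0 := by omega
      simp
    · obtain rfl : j = N := by omega
      rw [Int.cast_natCast, mul_div_cancel₀ _ hN', Real.sin_pi]
  · rfl

theorem sineBump_recurrence (hN : 0 < N) (j : ℤ) :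
    sineBump N j * sineBump N (j + 1) + sineBump N j * sineBump N (j - 1)
      = 2 * Real.cos (Real.pi / N) * sineBump N j ^ 2 := by
  by_cases h : j ≤ 0 ∨ N ≤ j
  · simp [sineBump_eq_zero hN h]
  · push Not at h
    have h1 : 0 ≤ j ∧ j ≤ N := by omega
    have h2 : 0 ≤ j + 1 ∧ j + 1 ≤ N := by omega
    have h3 : 0 ≤ j - 1 ∧ j - 1 ≤ N := by omega
    simp only [sineBump, if_pos h1, if_pos h2, if_pos h3]
    push_cast
    rw [add_mul, sub_mul, Real.sin_add, Real.sin_sub, one_mul]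
    ring

theorem lt_of_sineBump_ne_zero (hN : 0 < N) {j : ℤ} (h : sineBump N j ≠ 0) : 0 < j ∧ j < N := by
  contrapose! h
  exact sineBump_eq_zero hN (by omega)

theorem noiseMass_pos (hN : 2 ≤ N) : 0 < noiseMass N := by
  have h1 : 0 < sineBump N 1 := by
    have hN' : (2 : ℝ) ≤ N := by exact_mod_cast hN
    rw [sineBump, if_pos (by omega)]
    refine Real.sin_pos_of_pos_of_lt_pi (by have := Real.pi_pos; positivity) ?_
    rw [Int.cast_one, one_mul, div_lt_iff₀ (by linarith)]
    nlinarith [Real.pi_pos]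
  have hle := Finset.single_le_sum (f := fun d : Fin (N + 1) => sineBump N (d : ℕ) ^ 2)
    (fun _ _ => sq_nonneg _) (Finset.mem_univ ⟨1, by omega⟩)
  have hpos : 0 < sineBump N ((1 : ℕ) : ℤ) ^ 2 := by
    rw [Nat.cast_one]
    positivity
  exact hpos.trans_le hle

theorem noise_nonneg (j : ℤ) : 0 ≤ noise N j :=
  div_nonneg (sq_nonneg _) (Finset.sum_nonneg fun _ _ => sq_nonneg _)

theorem lt_of_noise_ne_zero (hN : 0 < N) {j : ℤ} (h : noise N j ≠ 0) : 0 < j ∧ j < N :=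
  lt_of_sineBump_ne_zero hN fun h0 => h (by simp [noise, h0])

theorem tsum_noise (hN : 2 ≤ N) : ∑' j, noise N j = 1 := by
  rw [← sum_fin_eq_tsum (N := N) fun j hj => by
    have := lt_of_noise_ne_zero (by omega) hj; omega]
  simp only [noise]
  rw [← Finset.sum_div]
  exact div_self (noiseMass_pos hN).ne'

theorem sum_noise_sub (hN : 2 ≤ N) {s : ℤ} (hs : |s| ≤ 1) :
    ∑ d : Fin (N + 1), noise N ((d : ℕ) - s) = 1 := by
  rw [abs_le] at hs
  rw [sum_fin_eq_tsum (g := fun j => noise N (j - s)) fun j hj => by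
    have := lt_of_noise_ne_zero (by omega) hj; omega]
  rw [← tsum_noise hN, ← (Equiv.subRight s).tsum_eq (noise N)]
  rfl

theorem sum_sineBump_mul (hN : 2 ≤ N) {s : ℤ} (hs : |s| = 1) :
    ∑ d : Fin (N + 1), sineBump N (d : ℕ) * sineBump N ((d : ℕ) - s)
      = Real.cos (Real.pi / N) * noiseMass N := by
  have hsupp : ∀ s j : ℤ, sineBump N j * sineBump N (j + s) ≠ 0 → 0 ≤ j ∧ j ≤ N :=
    fun s j hj => by
      have := lt_of_sineBump_ne_zero (by omega) (left_ne_zero_of_mul hj)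
      omega
  have hsymm : ∑ d : Fin (N + 1), sineBump N (d : ℕ) * sineBump N ((d : ℕ) + 1)
      = ∑ d : Fin (N + 1), sineBump N (d : ℕ) * sineBump N ((d : ℕ) + (-1)) := by
    rw [sum_fin_eq_tsum (hsupp 1), sum_fin_eq_tsum (hsupp (-1)),
      ← (Equiv.subRight (1 : ℤ)).tsum_eq]
    refine tsum_congr fun j => ?_
    rw [Equiv.subRight_apply, sub_add_cancel, mul_comm, sub_eq_add_neg]
  have hadd : ∑ d : Fin (N + 1), sineBump N (d : ℕ) * sineBump N ((d : ℕ) + 1)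
      + ∑ d : Fin (N + 1), sineBump N (d : ℕ) * sineBump N ((d : ℕ) + (-1))
      = 2 * Real.cos (Real.pi / N) * noiseMass N := by
    rw [← Finset.sum_add_distrib, noiseMass, Finset.mul_sum]
    refine Finset.sum_congr rfl fun d _ => ?_
    rw [← sub_eq_add_neg, sineBump_recurrence (by omega)]
  rcases (abs_eq zero_le_one).1 hs with rfl | rfl
  · simp only [sub_eq_add_neg]
    linarith
  · simp only [sub_neg_eq_add]
    linarith

theorem sqrt_noise_mul (i j : ℤ) :
    √(noise N i * noise N j) = sineBump N i * sineBump N j / noiseMass N := by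
  have hW : 0 ≤ noiseMass N := Finset.sum_nonneg fun _ _ => sq_nonneg _
  rw [noise, noise, show sineBump N i ^ 2 / noiseMass N * (sineBump N j ^ 2 / noiseMass N)
    = (sineBump N i * sineBump N j / noiseMass N) ^ 2 by ring]
  exact Real.sqrt_sq (div_nonneg (mul_nonneg (sineBump_nonneg i) (sineBump_nonneg j)) hW)

theorem noise_affinity (hN : 2 ≤ N) {s : ℤ} (hs : |s| = 1) :
    ∑ d : Fin (N + 1), √(noise N (d : ℕ) * noise N ((d : ℕ) - s)) = Real.cos (Real.pi / N) := by
  simp only [sqrt_noise_mul]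
  rw [← Finset.sum_div, sum_sineBump_mul hN hs, mul_div_cancel_right₀ _ (noiseMass_pos hN).ne']

end Noise

/-! ### The adversary -/

/-- The extension by zero of a finite sequence to all natural indices. -/
def pad {A : Type*} [Zero A] {t : ℕ} (x : Fin t → A) (i : ℕ) : A :=
  if h : i < t then x ⟨i, h⟩ else 0

/-- The action preceding the one with index `i`, with the convention that the action `0` precedes
the first one. -/
def prev (X : ℕ → Fin 2) : ℕ → Fin 2
  | 0 => 0
  | i + 1 => X i

/-- The change of action at index `i`, as an integer in `{-1, 0, 1}`. -/
def incr (X : ℕ → Fin 2) (i : ℕ) : ℤ := ((X i : ℕ) : ℤ) - ((prev X i : ℕ) : ℤ)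

/-- The unit cost for changing the action at index `i`; the first action is free. -/
noncomputable def switchCost (X : ℕ → Fin 2) : ℕ → ℝ
  | 0 => 0
  | i + 1 => if X (i + 1) = X i then 0 else 1

/-- The loss of action `a` at time `j` in the hidden bandit problem. The action `0` follows the
random walk of step `2 * δ * k i`, and the action `1` has the same loss up to `± δ`: it is better
if `Z = 0` and worse if `Z = 1`. In units of `2 * δ` the two cases differ by one lattice step. -/
noncomputable def walkLoss (δ : ℝ) (Z : ℤ) (k : ℕ → ℤ) (j : ℕ) (a : Fin 2) : ℝ :=
  2 * δ * ((∑ i ∈ range j, k i + Z * ((a : ℕ) : ℤ) : ℤ) : ℝ) - δ * ((a : ℕ) : ℝ)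

/-- The loss of round `s + 1` in terms of the actions `X 0, X 1, …`. It charges the action and the
switch of the preceding round, so it is constant in the action `X s` of the current round. -/
noncomputable def roundLoss (δ : ℝ) (Z : ℤ) (k : ℕ → ℤ) (X : ℕ → Fin 2) : ℕ → ℝ
  | 0 => 0
  | s + 1 => walkLoss δ Z k (s + 1) (X s) + switchCost X s

/-- The adversary with hidden parameter `Z` and noise `k`. -/
noncomputable def lossSeq (δ : ℝ) (Z : ℤ) (k : ℕ → ℤ) : LossSeq (Fin 2) :=
  fun t x => roundLoss δ Z k (pad x) (t - 1)

theorem pad_of_lt {A : Type*} [Zero A] {t i : ℕ} (x : Fin t → A) (h : i < t) :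
    pad x i = x ⟨i, h⟩ := dif_pos h

theorem pad_append {t i : ℕ} (x : Fin t → Fin 2) (a : Fin 2) (h : i < t) :
    pad (append x a) i = pad x i := by
  rw [pad_of_lt _ h, pad_of_lt _ (by omega)]
  exact Fin.snoc_castSucc (α := fun _ => Fin 2) a x ⟨i, h⟩

theorem pad_takeFirst {s t i : ℕ} (hst : s ≤ t) (x : Fin t → Fin 2) (h : i < s) :
    pad (takeFirst hst x) i = pad x i := by
  rw [pad_of_lt _ h, pad_of_lt _ (by omega)]
  rfl

theorem pad_init {A : Type*} [Zero A] {t i : ℕ} (x : Fin (t + 1) → A) (h : i < t) :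
    pad (Fin.init x) i = pad x i := by
  rw [pad_of_lt _ h, pad_of_lt _ (by omega)]
  rfl

theorem prev_congr {X X' : ℕ → Fin 2} {i : ℕ} (h : ∀ j < i, X j = X' j) : prev X i = prev X' i := by
  cases i with
  | zero => rfl
  | succ i => exact h i (by omega)

theorem incr_congr {X X' : ℕ → Fin 2} {i : ℕ} (h : ∀ j < i + 1, X j = X' j) :
    incr X i = incr X' i := by
  rw [incr, incr, h i (by omega), prev_congr fun j hj => h j (by omega)]

theorem abs_fin_two_sub_le (a b : Fin 2) : |((a : ℕ) : ℤ) - ((b : ℕ) : ℤ)| ≤ 1 := by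
  revert a b
  decide

theorem abs_fin_two_sub_eq {a b : Fin 2} (h : a ≠ b) : |((a : ℕ) : ℤ) - ((b : ℕ) : ℤ)| = 1 := by
  revert a b
  decide

theorem sum_incr (X : ℕ → Fin 2) (s : ℕ) : ∑ i ∈ range (s + 1), incr X i = ((X s : ℕ) : ℤ) := by
  induction s with
  | zero => simp [incr, prev]
  | succ s ih =>
    rw [sum_range_succ, ih]
    simp [incr, prev]

theorem switchCost_congr {X X' : ℕ → Fin 2} {s : ℕ} (h : ∀ i, i + 1 = s ∨ i = s → X i = X' i) :
    switchCost X s = switchCost X' s := by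
  cases s with
  | zero => rfl
  | succ s => rw [switchCost, switchCost, h s (by omega), h (s + 1) (by omega)]

theorem switchCost_nonneg (X : ℕ → Fin 2) (s : ℕ) : 0 ≤ switchCost X s := by
  cases s with
  | zero => exact le_rfl
  | succ s =>
    rw [switchCost]
    split_ifs <;> norm_num

theorem switchCost_le_one (X : ℕ → Fin 2) (s : ℕ) : switchCost X s ≤ 1 := by
  cases s with
  | zero => exact zero_le_one
  | succ s =>
    rw [switchCost]
    split_ifs <;> norm_num

theorem switchCost_const (a : Fin 2) (s : ℕ) : switchCost (fun _ => a) s = 0 := by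
  cases s with
  | zero => rfl
  | succ s => simp [switchCost]

theorem roundLoss_congr (δ : ℝ) (Z : ℤ) (k : ℕ → ℤ) {X X' : ℕ → Fin 2} {s : ℕ}
    (h : ∀ i, i < s → s ≤ i + 2 → X i = X' i) : roundLoss δ Z k X s = roundLoss δ Z k X' s := by
  cases s with
  | zero => rfl
  | succ s =>
    rw [roundLoss, roundLoss, h s (by omega) (by omega),
      switchCost_congr fun i hi => h i (by omega) (by omega)]

/-- The losses with parameter `Z` look like losses with parameter `0`, driven by a noise that is
translated at the rounds in which the player switches. -/
theorem roundLoss_eq_shifted (δ : ℝ) (Z : ℤ) {k d : ℕ → ℤ} {X : ℕ → Fin 2} {s : ℕ}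
    (h : ∀ i < s, d i = k i + Z * incr X i) : roundLoss δ Z k X s = roundLoss δ 0 d X s := by
  cases s with
  | zero => rfl
  | succ s =>
    have hsum : ∑ i ∈ range (s + 1), d i = ∑ i ∈ range (s + 1), k i + Z * ((X s : ℕ) : ℤ) := by
      rw [← sum_incr, mul_sum, ← sum_add_distrib]
      exact sum_congr rfl fun i hi => h i (mem_range.1 hi)
    rw [roundLoss, roundLoss, walkLoss, walkLoss, hsum, zero_mul, add_zero]

theorem feedback_lossSeq (δ : ℝ) (Z : ℤ) (k : ℕ → ℤ) {t : ℕ} (x : Fin t → Fin 2) (s : Fin t)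
    (a : Fin 2) : feedback (lossSeq δ Z k) x s a = roundLoss δ Z k (pad x) s := by
  refine roundLoss_congr δ Z k fun i hi _ => ?_
  have hi' : i < (s : ℕ) := hi
  rw [pad_append _ _ hi', pad_takeFirst _ _ hi']

theorem feedback_eq_shifted (δ : ℝ) (Z : ℤ) {k d : ℕ → ℤ} {t : ℕ} {x : Fin t → Fin 2}
    (h : ∀ i < t, d i = k i + Z * incr (pad x) i) :
    feedback (lossSeq δ Z k) x = feedback (lossSeq δ 0 d) x := by
  funext s a
  rw [feedback_lossSeq, feedback_lossSeq]
  exact roundLoss_eq_shifted δ Z fun i hi => h i (hi.trans s.isLt)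

theorem hasMemory_lossSeq (δ : ℝ) (Z : ℤ) (k : ℕ → ℤ) (T : ℕ) :
    HasMemory (lossSeq δ Z k) T 2 := by
  intro t ht _ x x' hxx
  refine roundLoss_congr δ Z k fun i hi his => ?_
  rw [pad_of_lt _ (by omega), pad_of_lt _ (by omega)]
  exact hxx _ (by simp only; omega)

/-- Up to the common random walk, the losses of the two actions differ by at most the gap. -/
theorem abs_walkLoss_sub_le {δ : ℝ} (hδ : 0 ≤ δ) {Z : ℤ} (hZ : Z = 0 ∨ Z = 1) (k : ℕ → ℤ) (j : ℕ)
    (a b : Fin 2) : |walkLoss δ Z k j a - walkLoss δ Z k j b| ≤ δ := by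
  rw [abs_le]
  rcases hZ with rfl | rfl <;> fin_cases a <;> fin_cases b <;> simp [walkLoss] <;>
    (try constructor) <;> linarith

theorem hasRange_lossSeq {δ : ℝ} (hδ : 0 ≤ δ) (hδ1 : δ ≤ 1) {Z : ℤ} (hZ : Z = 0 ∨ Z = 1)
    (k : ℕ → ℤ) (T : ℕ) : HasRange (lossSeq δ Z k) T 2 := by
  intro t _ _ x x'
  simp only [lossSeq]
  cases t - 1 with
  | zero => simp [roundLoss]
  | succ s =>
    have h1 := abs_le.1 (abs_walkLoss_sub_le hδ hZ k (s + 1) (pad x s) (pad x' s))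
    have h2 := switchCost_nonneg (pad x) s
    have h3 := switchCost_nonneg (pad x') s
    have h4 := switchCost_le_one (pad x) s
    have h5 := switchCost_le_one (pad x') s
    rw [roundLoss, roundLoss, abs_le]
    constructor <;> linarith [h1.1, h1.2]

theorem hasDrift_lossSeq {δ : ℝ} (hδ : 0 ≤ δ) (hδ1 : δ ≤ 1) {Z : ℤ} (hZ : Z = 0 ∨ Z = 1)
    {k : ℕ → ℤ} (hk : ∀ i, 0 ≤ k i) (hk' : ∀ i, δ * k i ≤ 1) (T : ℕ) {D : ℕ → ℝ}
    (hD : ∀ t, 1 ≤ t → 4 ≤ D t) : HasDrift (lossSeq δ Z k) T D := by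
  intro s _ x
  refine le_trans ?_ (hD (s + 1) (by omega))
  set X := pad x
  have e1 : lossSeq δ Z k (s + 1) x = roundLoss δ Z k X s := rfl
  have e2 : lossSeq δ Z k (s + 2) (append x (x (Fin.last s))) = roundLoss δ Z k X (s + 1) :=
    roundLoss_congr δ Z k fun i hi _ => pad_append _ _ hi
  rw [e1, e2]
  have hk0 : (0 : ℝ) ≤ k s := by exact_mod_cast hk s
  have hk1 := hk' s
  have hk2 := mul_nonneg hδ hk0
  have h4 := switchCost_nonneg X s
  have h5 := switchCost_le_one X s
  cases s with
  | zero =>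
    have h0 : |walkLoss δ Z k 1 (X 0) - 2 * δ * k 0| ≤ δ := by
      convert abs_walkLoss_sub_le hδ hZ k 1 (X 0) 0 using 2
      simp [walkLoss]
    have h0 := abs_le.1 h0
    rw [roundLoss, roundLoss, abs_le]
    constructor <;> linarith [h0.1, h0.2]
  | succ s =>
    have h0 : |walkLoss δ Z k (s + 2) (X (s + 1)) - (walkLoss δ Z k (s + 1) (X s)
        + 2 * δ * k (s + 1))| ≤ δ := by
      convert abs_walkLoss_sub_le hδ hZ k (s + 2) (X (s + 1)) (X s) using 2
      simp only [walkLoss, sum_range_succ _ (s + 1)]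
      push_cast
      ring
    have h0 := abs_le.1 h0
    have h6 := switchCost_nonneg X s
    have h7 := switchCost_le_one X s
    rw [roundLoss, roundLoss, abs_le]
    constructor <;> linarith [h0.1, h0.2]

/-! ### Regret -/

/-- The number of times, among the first `n`, that the worse action is played. -/
noncomputable def badCount (Z : ℤ) (n : ℕ) (X : ℕ → Fin 2) : ℝ :=
  ∑ j ∈ range n, if Z = 0 then 1 - ((X j : ℕ) : ℝ) else ((X j : ℕ) : ℝ)

/-- The number of switches among the first `n` actions. -/
noncomputable def switchCount (n : ℕ) (X : ℕ → Fin 2) : ℝ := ∑ j ∈ range n, switchCost X j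

theorem cumulativeLoss_lossSeq (δ : ℝ) (Z : ℤ) (k : ℕ → ℤ) {n : ℕ} (x : Fin (n + 1) → Fin 2)
    {X : ℕ → Fin 2} (hX : ∀ i < n, pad x i = X i) :
    cumulativeLoss (lossSeq δ Z k) x
      = ∑ j ∈ range n, (walkLoss δ Z k (j + 1) (X j) + switchCost X j) := by
  have h : cumulativeLoss (lossSeq δ Z k) x = ∑ t : Fin (n + 1), roundLoss δ Z k X t := by
    refine sum_congr rfl fun t _ => roundLoss_congr δ Z k fun i hi _ => ?_
    have hi' : i < (t : ℕ) := hi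
    rw [pad_takeFirst _ _ (by omega), hX i (by omega)]
  rw [h, Fin.sum_univ_eq_sum_range, sum_range_succ']
  simp [roundLoss]

theorem le_regret {δ : ℝ} {Z : ℤ} (hZ : Z = 0 ∨ Z = 1) (k : ℕ → ℤ) {n : ℕ}
    (x : Fin n → Fin 2) (a : Fin 2) :
    δ * badCount Z n (pad x) + switchCount n (pad x) ≤ regret (lossSeq δ Z k) (append x a) := by
  -- the better action
  let b : Fin 2 := if Z = 0 then 1 else 0
  have h1 : Finset.univ.inf' Finset.univ_nonempty
      (fun a : Fin 2 => cumulativeLoss (lossSeq δ Z k) (fun _ : Fin (n + 1) => a))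
      ≤ cumulativeLoss (lossSeq δ Z k) (fun _ : Fin (n + 1) => b) :=
    Finset.inf'_le _ (Finset.mem_univ b)
  rw [cumulativeLoss_lossSeq δ Z k (fun _ => b) (X := fun _ => b)
    fun i hi => pad_of_lt _ (by omega)] at h1
  rw [regret, cumulativeLoss_lossSeq δ Z k (append x a) fun i hi => pad_append x a hi]
  refine le_trans (le_of_eq ?_) (sub_le_sub_left h1 _)
  rw [badCount, switchCount, mul_sum, ← sum_add_distrib, ← sum_sub_distrib]
  refine sum_congr rfl fun j _ => ?_
  rw [switchCost_const]
  rcases hZ with rfl | rfl <;> simp [walkLoss, b] <;> ring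

/-! ### The law of the observed history -/

theorem actionLaw_append (σ : FullInfoStrategy (Fin 2)) (f : LossSeq (Fin 2)) {t : ℕ}
    (x : Fin t → Fin 2) (a : Fin 2) :
    actionLaw σ f (t + 1) (append x a) = actionLaw σ f t x * σ t x (feedback f x) a := by
  have hinj : ∀ (y : Fin t → Fin 2) (b : Fin 2), append x a = append y b ↔ x = y ∧ a = b := by
    intro y b
    exact Fin.snoc_inj
  rw [actionLaw, PMF.bind_apply, tsum_eq_single x]
  · rw [PMF.map_apply, tsum_eq_single a]
    · rw [if_pos rfl]
    · intro b hb
      rw [if_neg fun h => hb ((hinj _ _).1 h).2.symm]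
  · intro y hy
    rw [PMF.map_apply, ENNReal.tsum_eq_zero.2, mul_zero]
    intro b
    rw [if_neg fun h => hy ((hinj _ _).1 h).1.symm]

theorem sum_pmf_toReal {A : Type*} [Fintype A] (p : PMF A) : ∑ a, (p a).toReal = 1 := by
  rw [← ENNReal.toReal_sum fun a _ => p.apply_ne_top a, ← tsum_fintype (L := .unconditional _),
    p.tsum_coe, ENNReal.toReal_one]

theorem le_expectedRegret {δ : ℝ} {Z : ℤ} (hZ : Z = 0 ∨ Z = 1) (k : ℕ → ℤ) (n : ℕ)
    (σ : FullInfoStrategy (Fin 2)) :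
    ∑ x : Fin n → Fin 2, (actionLaw σ (lossSeq δ Z k) n x).toReal
      * (δ * badCount Z n (pad x) + switchCount n (pad x))
      ≤ expectedRegret σ (lossSeq δ Z k) (n + 1) := by
  rw [expectedRegret, sum_snoc]
  refine sum_le_sum fun x _ => ?_
  rw [← mul_one (δ * badCount Z n (pad x) + _),
    ← sum_pmf_toReal (σ n x (feedback (lossSeq δ Z k) x)), mul_sum, mul_sum]
  refine sum_le_sum fun a _ => ?_
  have h := actionLaw_append σ (lossSeq δ Z k) x a
  rw [append] at h
  rw [h, ENNReal.toReal_mul]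
  have hr := le_regret hZ (δ := δ) k x a
  rw [append] at hr
  have := mul_le_mul_of_nonneg_left hr (mul_nonneg
    (ENNReal.toReal_nonneg (a := actionLaw σ (lossSeq δ Z k) n x))
    (ENNReal.toReal_nonneg (a := σ n x (feedback (lossSeq δ Z k) x) a)))
  linarith

section Observed

variable {N : ℕ}

/-- The probability that the strategy plays `a` after a history of actions and of observed
increments of the loss. The observations determine the feedback: it is the one that the losses with
parameter `0` and with the observed increments as noise would produce. -/
noncomputable def playProb (σ : FullInfoStrategy (Fin 2)) (δ : ℝ) (t : ℕ)
    (h : Fin t → Fin 2 × Fin (N + 1)) (a : Fin 2) : ℝ :=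
  (σ t (fun i => (h i).1) (feedback (lossSeq δ 0 (pad fun i => (((h i).2 : ℕ) : ℤ)))
    (fun i => (h i).1)) a).toReal

/-- The last action of a history. -/
def lastAction (t : ℕ) (h : Fin t → Fin 2 × Fin (N + 1)) : Fin 2 := prev (pad fun i => (h i).1) t

/-- The conditional law, under the parameter `Z`, of the next action and of the increment observed
through it: the latter is the noise, translated by `Z` times the change of action. -/
noncomputable def stepLaw (σ : FullInfoStrategy (Fin 2)) (δ : ℝ) (Z : ℤ) (t : ℕ)
    (h : Fin t → Fin 2 × Fin (N + 1)) (y : Fin 2 × Fin (N + 1)) : ℝ :=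
  playProb σ δ t h y.1 * noise N ((y.2 : ℕ) - Z * (((y.1 : ℕ) : ℤ) - ((lastAction t h : ℕ) : ℤ)))

/-- The indicator that the next action is a switch. Here the first action counts as a switch if it
is `1`. -/
noncomputable def switchInd (t : ℕ) (h : Fin t → Fin 2 × Fin (N + 1)) (y : Fin 2 × Fin (N + 1)) :
    ℝ := if y.1 = lastAction t h then 0 else 1

/-- The conditional probability of a switch. -/
noncomputable def switchProb (σ : FullInfoStrategy (Fin 2)) (δ : ℝ) (t : ℕ)
    (h : Fin t → Fin 2 × Fin (N + 1)) : ℝ :=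
  ∑ a, playProb σ δ t h a * if a = lastAction t h then 0 else 1

variable (σ : FullInfoStrategy (Fin 2)) (δ : ℝ)

theorem playProb_nonneg (t : ℕ) (h : Fin t → Fin 2 × Fin (N + 1)) (a : Fin 2) :
    0 ≤ playProb σ δ t h a := ENNReal.toReal_nonneg

theorem sum_playProb (t : ℕ) (h : Fin t → Fin 2 × Fin (N + 1)) : ∑ a, playProb σ δ t h a = 1 :=
  sum_pmf_toReal _

theorem stepLaw_nonneg (Z : ℤ) (t : ℕ) (h : Fin t → Fin 2 × Fin (N + 1)) (y) :
    0 ≤ stepLaw σ δ Z t h y := mul_nonneg (playProb_nonneg σ δ t h _) (noise_nonneg _)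

theorem switchProb_nonneg (t : ℕ) (h : Fin t → Fin 2 × Fin (N + 1)) : 0 ≤ switchProb σ δ t h := by
  refine sum_nonneg fun a _ => mul_nonneg (playProb_nonneg σ δ t h a) ?_
  split_ifs <;> norm_num

theorem sum_noise_shift (hN : 2 ≤ N) {Z : ℤ} (hZ : Z = 0 ∨ Z = 1) (a b : Fin 2) :
    ∑ d : Fin (N + 1), noise N ((d : ℕ) - Z * (((a : ℕ) : ℤ) - ((b : ℕ) : ℤ))) = 1 := by
  refine sum_noise_sub hN ?_
  rcases hZ with rfl | rfl
  · simp
  · rw [one_mul]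
    exact abs_fin_two_sub_le a b

theorem sum_stepLaw (hN : 2 ≤ N) {Z : ℤ} (hZ : Z = 0 ∨ Z = 1) (t : ℕ)
    (h : Fin t → Fin 2 × Fin (N + 1)) : ∑ y, stepLaw σ δ Z t h y = 1 := by
  simp only [stepLaw, Fintype.sum_prod_type, ← mul_sum, sum_noise_shift hN hZ, mul_one,
    sum_playProb]

theorem sum_stepLaw_mul_switchInd (hN : 2 ≤ N) {Z : ℤ} (hZ : Z = 0 ∨ Z = 1) (t : ℕ)
    (h : Fin t → Fin 2 × Fin (N + 1)) :
    ∑ y, stepLaw σ δ Z t h y * switchInd t h y = switchProb σ δ t h := by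
  rw [Fintype.sum_prod_type, switchProb]
  refine sum_congr rfl fun a _ => ?_
  change ∑ d : Fin (N + 1), playProb σ δ t h a
    * noise N ((d : ℕ) - Z * (((a : ℕ) : ℤ) - ((lastAction t h : ℕ) : ℤ)))
    * (if a = lastAction t h then (0 : ℝ) else 1) = _
  rw [← sum_mul, ← mul_sum, sum_noise_shift hN hZ, mul_one]

/-- Only a switch reveals information on the hidden parameter. -/
theorem affinity_stepLaw (hN : 2 ≤ N) (t : ℕ) (h : Fin t → Fin 2 × Fin (N + 1)) :
    1 - (1 - Real.cos (Real.pi / N)) * switchProb σ δ t h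
      = ∑ y, √(stepLaw σ δ 0 t h y * stepLaw σ δ 1 t h y) := by
  have hfac : ∀ (a : Fin 2) (d : Fin (N + 1)),
      √(stepLaw σ δ 0 t h (a, d) * stepLaw σ δ 1 t h (a, d))
        = playProb σ δ t h a * √(noise N (d : ℕ)
          * noise N ((d : ℕ) - (((a : ℕ) : ℤ) - ((lastAction t h : ℕ) : ℤ)))) := fun a d => by
    simp only [stepLaw, zero_mul, sub_zero, one_mul]
    rw [mul_mul_mul_comm, Real.sqrt_mul (mul_self_nonneg _),
      Real.sqrt_mul_self (playProb_nonneg σ δ t h a)]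
  rw [Fintype.sum_prod_type, switchProb, mul_sum]
  nth_rewrite 1 [← sum_playProb σ δ t h]
  rw [← sum_sub_distrib]
  refine sum_congr rfl fun a _ => ?_
  simp only [hfac]
  rw [← mul_sum]
  by_cases ha : a = lastAction t h
  · rw [if_pos ha, ha, sub_self]
    simp only [sub_zero, Real.sqrt_mul_self (noise_nonneg _)]
    rw [show ∑ d : Fin (N + 1), noise N (d : ℕ) = 1 by simpa using sum_noise_sub hN (s := 0)]
    ring
  · rw [if_neg ha, noise_affinity hN (abs_fin_two_sub_eq ha)]
    ring

/-- The number of switches that reveal information exceeds the number of charged switches by at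
most one, for the first action. -/
theorem chainCost_switchInd_le (t : ℕ) (h : Fin t → Fin 2 × Fin (N + 1)) :
    chainCost switchInd t h ≤ switchCount t (pad fun i => (h i).1) + 1 := by
  suffices H : ∀ t (h : Fin t → Fin 2 × Fin (N + 1)),
      chainCost switchInd t h ≤ switchCount t (pad fun i => (h i).1) + if t = 0 then 0 else 1 by
    refine (H t h).trans ?_
    split_ifs <;> linarith
  intro t
  induction t with
  | zero => intro h; simp [chainCost, switchCount]
  | succ t ih =>
    intro h
    have h1 := ih (Fin.init h)
    have e1 : switchCount t (pad fun i => (Fin.init h i).1) = switchCount t (pad fun i => (h i).1) :=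
      sum_congr rfl fun j hj => switchCost_congr fun i hi =>
        pad_init (fun i => (h i).1) (by have := mem_range.1 hj; omega)
    have e2 : lastAction t (Fin.init h) = prev (pad fun i => (h i).1) t :=
      prev_congr fun j hj => pad_init (fun i => (h i).1) hj
    have e3 : (h (Fin.last t)).1 = pad (fun i => (h i).1) t := by
      rw [pad_of_lt _ (by omega)]
      rfl
    rw [e1] at h1
    rw [chainCost, switchCount, sum_range_succ, ← switchCount, switchInd, e2, e3]
    cases t with
    | zero =>
      simp only [if_true] at h1
      simp only [switchCost, Nat.succ_ne_zero, if_false]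
      split_ifs <;> linarith
    | succ t =>
      simp only [Nat.succ_ne_zero, if_false] at h1 ⊢
      rw [switchCost, prev]
      linarith

/-- The law of actions and observations factors into the law of the actions against the adversary
with parameter `Z` and noise `k` and the probability of that noise. -/
theorem chainLaw_stepLaw (Z : ℤ) (k : ℕ → ℤ) : ∀ (t : ℕ) (x : Fin t → Fin 2)
    (d : Fin t → Fin (N + 1)) (_ : ∀ i : Fin t, ((d i : ℕ) : ℤ) = k i + Z * incr (pad x) i),
    chainLaw (stepLaw σ δ Z) t (fun i => (x i, d i))
      = (∏ i : Fin t, noise N (k i)) * (actionLaw σ (lossSeq δ Z k) t x).toReal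
  | 0, x, d, _ => by
    have hx : x = Fin.elim0 := Subsingleton.elim _ _
    simp [chainLaw, actionLaw, hx]
  | t + 1, x, d, hd => by
    have hinit : ∀ i, i < t → pad (Fin.init x) i = pad x i := fun i hi => pad_init x hi
    have hd' : ∀ i : Fin t, ((Fin.init d i : ℕ) : ℤ) = k i + Z * incr (pad (Fin.init x)) i :=
      fun i => by
        rw [incr_congr fun j hj => hinit j (by omega)]
        exact hd i.castSucc
    have ih := chainLaw_stepLaw Z k t (Fin.init x) (Fin.init d) hd'
    have hx : x = append (Fin.init x) (x (Fin.last t)) := (Fin.snoc_init_self x).symm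
    have hfb : feedback (lossSeq δ Z k) (Fin.init x)
        = feedback (lossSeq δ 0 (pad fun i => ((Fin.init d i : ℕ) : ℤ))) (Fin.init x) :=
      feedback_eq_shifted δ Z fun i hi => by
        rw [pad_of_lt _ hi]
        exact hd' ⟨i, hi⟩
    have hnoise : ((d (Fin.last t) : ℕ) : ℤ) - Z * (((x (Fin.last t) : ℕ) : ℤ)
        - ((prev (pad (Fin.init x)) t : ℕ) : ℤ)) = k t := by
      have h1 := hd (Fin.last t)
      rw [Fin.val_last, incr, pad_of_lt x (Nat.lt_succ_self t), ← prev_congr hinit] at h1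
      rw [h1]
      exact add_sub_cancel_right _ _
    have hlaw : (actionLaw σ (lossSeq δ Z k) (t + 1) x).toReal
        = (actionLaw σ (lossSeq δ Z k) t (Fin.init x)).toReal
          * (σ t (Fin.init x) (feedback (lossSeq δ Z k) (Fin.init x)) (x (Fin.last t))).toReal := by
      conv_lhs => rw [hx]
      rw [actionLaw_append, ENNReal.toReal_mul]
    have hstep : stepLaw σ δ Z t (fun i => (Fin.init x i, Fin.init d i))
        (x (Fin.last t), d (Fin.last t))
        = (σ t (Fin.init x) (feedback (lossSeq δ Z k) (Fin.init x)) (x (Fin.last t))).toReal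
          * noise N (k t) := by
      rw [stepLaw, playProb, hfb]
      congr 2
    rw [Fin.prod_univ_castSucc, hlaw, chainLaw]
    change chainLaw (stepLaw σ δ Z) t (fun i => (Fin.init x i, Fin.init d i))
      * stepLaw σ δ Z t (fun i => (Fin.init x i, Fin.init d i))
        (x (Fin.last t), d (Fin.last t)) = _
    rw [ih, hstep]
    simp only [Fin.val_castSucc, Fin.val_last]
    ring

/-- Averaging over the noise the law of the actions gives the law of the observed history, after
the change of variables from the noise to the observed increments. -/
theorem sum_noise_mul_actionLaw (hN : 2 ≤ N) {Z : ℤ} (hZ : Z = 0 ∨ Z = 1) {n : ℕ}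
    (φ : (Fin n → Fin 2) → ℝ) :
    ∑ k : Fin n → Fin (N + 1), (∏ i, noise N (k i : ℕ))
        * ∑ x, (actionLaw σ (lossSeq δ Z (pad fun i => ((k i : ℕ) : ℤ))) n x).toReal * φ x
      = ∑ h, chainLaw (stepLaw (N := N) σ δ Z) n h * φ (fun i => (h i).1) := by
  rw [← (Equiv.arrowProdEquivProdArrow (Fin n) (fun _ => Fin 2) (fun _ => Fin (N + 1))).symm.sum_comp,
    Fintype.sum_prod_type]
  simp only [mul_sum]
  rw [sum_comm]
  refine sum_congr rfl fun x _ => ?_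
  simp only [← mul_assoc, ← sum_mul]
  have hsupp : ∀ k : Fin n → ℤ, (∏ i, noise N (k i))
      * (actionLaw σ (lossSeq δ Z (pad k)) n x).toReal ≠ 0 → ∀ i, 0 < k i ∧ k i < N :=
    fun k hk i => lt_of_noise_ne_zero (by omega)
      (Finset.prod_ne_zero_iff.1 (left_ne_zero_of_mul hk) i (mem_univ i))
  have hshift := sum_cube_translate (N := N)
    (H := fun k => (∏ i, noise N (k i)) * (actionLaw σ (lossSeq δ Z (pad k)) n x).toReal)
    (s := fun i => Z * incr (pad x) i)
    (fun k hk i => by have := hsupp k hk i; omega)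
    (fun k hk i => by
      have h1 := hsupp k hk i
      have h2 := abs_le.1 (abs_fin_two_sub_le (pad x i) (prev (pad x) i))
      rw [incr]
      rcases hZ with rfl | rfl
      · omega
      · omega)
  simp only at hshift
  change _ = ∑ d : Fin n → Fin (N + 1), chainLaw (stepLaw σ δ Z) n (fun i => (x i, d i)) * φ x
  rw [hshift, ← sum_mul]
  refine congrArg (· * φ x) (sum_congr rfl fun d _ => ?_)
  have hpad : ∀ i : Fin n, pad (fun i : Fin n => ((d i : ℕ) : ℤ) - Z * incr (pad x) i) i
      = ((d i : ℕ) : ℤ) - Z * incr (pad x) i := fun i => pad_of_lt _ i.isLt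
  have h := chainLaw_stepLaw σ δ Z (pad fun i : Fin n => ((d i : ℕ) : ℤ) - Z * incr (pad x) i) n x d
    fun i => by rw [hpad]; ring
  simp only [hpad] at h
  exact h.symm

end Observed

/-! ### The lower bound -/

/-- A lower bound on the sum of the expected regrets against the adversaries with parameters `0` and
`1`. The information revealed by one switch is `1 - cos (π / N)`; the hypothesis says that its value
to the player, who can save at most about `δ * n`, does not exceed the unit cost of the switch. Then
the number of switches drops out of the bound. -/
theorem two_world_bound (σ : FullInfoStrategy (Fin 2)) {δ : ℝ} (hδ : 0 ≤ δ) {N : ℕ} (hN : 2 ≤ N)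
    (n : ℕ) (hc : 15 / 16 * (δ * n * (1 - Real.cos (Real.pi / N))) ≤ 1) :
    δ * n * (3 / 4 - 15 / 8 * (1 - Real.cos (Real.pi / N)))
      ≤ ∑ h, chainLaw (stepLaw (N := N) σ δ 0) n h
          * (δ * badCount 0 n (pad fun i => (h i).1) + switchCount n (pad fun i => (h i).1))
        + ∑ h, chainLaw (stepLaw (N := N) σ δ 1) n h
          * (δ * badCount 1 n (pad fun i => (h i).1) + switchCount n (pad fun i => (h i).1)) := by
  set c := 1 - Real.cos (Real.pi / N) with hcdef
  have hc0 : 0 ≤ c := sub_nonneg.2 (Real.cos_le_one _)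
  have hP₀ := chainLaw_nonneg (stepLaw_nonneg (N := N) σ δ 0) n
  have hP₁ := chainLaw_nonneg (stepLaw_nonneg (N := N) σ δ 1) n
  have hS₀ := sum_stepLaw (N := N) σ δ hN (Z := 0) (Or.inl rfl)
  have hS₁ := sum_stepLaw (N := N) σ δ hN (Z := 1) (Or.inr rfl)
  have hT₀ := sum_chainLaw hS₀ n
  have hT₁ := sum_chainLaw hS₁ n
  have haff := one_sub_affinity_le hc0 (stepLaw_nonneg (N := N) σ δ 0) (stepLaw_nonneg σ δ 1)
    hS₀ hS₁ (switchProb_nonneg σ δ)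
    (sum_stepLaw_mul_switchInd σ δ hN (Or.inl rfl)) (sum_stepLaw_mul_switchInd σ δ hN (Or.inr rfl))
    (fun t h => (affinity_stepLaw σ δ hN t h).le) n
  set P₀ := chainLaw (stepLaw (N := N) σ δ 0) n
  set P₁ := chainLaw (stepLaw (N := N) σ δ 1) n
  let φ : (Fin n → Fin 2 × Fin (N + 1)) → ℝ := fun h => badCount 0 n (pad fun i => (h i).1)
  let M : (Fin n → Fin 2 × Fin (N + 1)) → ℝ := fun h => switchCount n (pad fun i => (h i).1)
  have hbad : ∀ h : Fin n → Fin 2 × Fin (N + 1),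
      badCount 1 n (pad fun i => (h i).1) = n - φ h := fun h => by
    simp [φ, badCount]
  have hval : ∀ a : Fin 2, (0 : ℝ) ≤ ((a : ℕ) : ℝ) ∧ ((a : ℕ) : ℝ) ≤ 1 := fun a =>
    ⟨Nat.cast_nonneg _, by exact_mod_cast Nat.le_of_lt_succ a.isLt⟩
  have hφ0 : ∀ h, 0 ≤ φ h := fun h => sum_nonneg fun j _ => by
    rw [if_pos rfl]
    linarith [(hval (pad (fun i => (h i).1) j)).2]
  have hφn : ∀ h, φ h ≤ n := fun h => by
    have h1 : 0 ≤ badCount 1 n (pad fun i => (h i).1) := sum_nonneg fun j _ => by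
      rw [if_neg one_ne_zero]
      exact (hval _).1
    linarith [hbad h]
  have htwo := two_point_bound hP₀ hP₁ hT₀ hT₁ hφ0 hφn (Nat.cast_nonneg n)
  have hcost : ∀ P : (Fin n → Fin 2 × Fin (N + 1)) → ℝ, (∀ h, 0 ≤ P h) → ∑ h, P h = 1 →
      ∑ h, P h * chainCost switchInd n h ≤ ∑ h, P h * M h + 1 := fun P hP hP1 => by
    rw [← hP1, ← sum_add_distrib]
    refine sum_le_sum fun h _ => ?_
    have := mul_le_mul_of_nonneg_left (chainCost_switchInd_le n h) (hP h)
    linarith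
  have hcost₀ := hcost P₀ hP₀ hT₀
  have hcost₁ := hcost P₁ hP₁ hT₁
  have hM : ∀ P : (Fin n → Fin 2 × Fin (N + 1)) → ℝ, (∀ h, 0 ≤ P h) → 0 ≤ ∑ h, P h * M h :=
    fun P hP => sum_nonneg fun h _ => mul_nonneg (hP h) (sum_nonneg fun j _ => switchCost_nonneg _ j)
  have hM₀ := hM P₀ hP₀
  have hM₁ := hM P₁ hP₁
  have hsplit₀ : ∑ h, P₀ h * (δ * φ h + M h) = δ * ∑ h, P₀ h * φ h + ∑ h, P₀ h * M h := by
    rw [mul_sum, ← sum_add_distrib]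
    exact sum_congr rfl fun h _ => by ring
  have hsplit₁ : ∑ h, P₁ h * (δ * (n - φ h) + M h)
      = δ * ∑ h, P₁ h * (n - φ h) + ∑ h, P₁ h * M h := by
    rw [mul_sum, ← sum_add_distrib]
    exact sum_congr rfl fun h _ => by ring
  simp only [hbad]
  change _ ≤ ∑ h, P₀ h * (δ * φ h + M h) + ∑ h, P₁ h * (δ * (n - φ h) + M h)
  rw [hsplit₀, hsplit₁]
  set m₀ := ∑ h, P₀ h * M h
  set m₁ := ∑ h, P₁ h * M h
  have hinfo : 1 - ∑ h, √(P₀ h * P₁ h) ≤ c * ((m₀ + m₁) / 2 + 1) :=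
    haff.trans (mul_le_mul_of_nonneg_left (by linarith) hc0)
  have hδn : 0 ≤ δ * n := mul_nonneg hδ (Nat.cast_nonneg n)
  have e1 := mul_le_mul_of_nonneg_left htwo hδ
  have e2 := mul_le_mul_of_nonneg_left hinfo hδn
  have e3 := mul_le_mul_of_nonneg_right hc (add_nonneg hM₀ hM₁)
  linarith

/-- A bound on the expected regret that is averaged over the noise and the parameter is
attained by one adversary. -/
theorem exists_noise (σ : FullInfoStrategy (Fin 2)) {δ : ℝ} {N : ℕ} (hN : 2 ≤ N) {n : ℕ} {B : ℝ}
    (hB : 2 * B < ∑ h, chainLaw (stepLaw (N := N) σ δ 0) n h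
          * (δ * badCount 0 n (pad fun i => (h i).1) + switchCount n (pad fun i => (h i).1))
        + ∑ h, chainLaw (stepLaw (N := N) σ δ 1) n h
          * (δ * badCount 1 n (pad fun i => (h i).1) + switchCount n (pad fun i => (h i).1))) :
    ∃ Z : ℤ, (Z = 0 ∨ Z = 1) ∧ ∃ k : Fin n → Fin (N + 1),
      B ≤ expectedRegret σ (lossSeq δ Z (pad fun i => ((k i : ℕ) : ℤ))) (n + 1) := by
  by_contra! hcon
  have hle : ∀ Z : ℤ, (Z = 0 ∨ Z = 1) → ∑ h, chainLaw (stepLaw (N := N) σ δ Z) n h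
      * (δ * badCount Z n (pad fun i => (h i).1) + switchCount n (pad fun i => (h i).1)) ≤ B := by
    intro Z hZ
    have hmass : ∑ k : Fin n → Fin (N + 1), ∏ i, noise N (k i : ℕ) = 1 := by
      rw [← Fintype.sum_pow (fun d : Fin (N + 1) => noise N (d : ℕ)),
        show ∑ d : Fin (N + 1), noise N (d : ℕ) = 1 by simpa using sum_noise_sub hN (s := 0),
        one_pow]
    rw [← sum_noise_mul_actionLaw σ δ hN hZ
      (fun x => δ * badCount Z n (pad x) + switchCount n (pad x)),
      ← one_mul B, ← hmass, sum_mul]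
    exact sum_le_sum fun k _ => mul_le_mul_of_nonneg_left
      ((le_expectedRegret hZ _ n σ).trans (hcon Z hZ k).le) (prod_nonneg fun i _ => noise_nonneg _)
  linarith [hle 0 (Or.inl rfl), hle 1 (Or.inr rfl)]

end RepeatedGame

theorem theorem2 (T : ℕ) (hT : 2 ≤ T) (σ : RepeatedGame.FullInfoStrategy (Fin 2)) :
    ∃ f : RepeatedGame.LossSeq (Fin 2),
      RepeatedGame.HasMemory f T 2 ∧
      RepeatedGame.HasRange f T 2 ∧
      RepeatedGame.HasDrift f T (fun t => Real.sqrt (3 * Real.log (t : ℝ) + 18)) ∧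
      (1 / 40 : ℝ) * ((T : ℝ) - 1) ^ ((2 : ℝ) / 3) ≤ RepeatedGame.expectedRegret σ f T := by
  obtain ⟨n, rfl⟩ : ∃ n, T = n + 1 := ⟨T - 1, by omega⟩
  have hn : (1 : ℝ) ≤ n := by exact_mod_cast (by omega : 1 ≤ n)
  -- `r = n ^ (1/3)`; the gap is of order `1 / r`, at most one eighth, and the noise has about
  -- `8 * r` atoms at distance of twice the gap, so that it has bounded support
  set r : ℝ := (n : ℝ) ^ ((1 : ℝ) / 3) with hr
  have hr1 : 1 ≤ r := Real.one_le_rpow hn (by norm_num)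
  have hr3 : r ^ 3 = n := by
    rw [hr, ← Real.rpow_natCast, ← Real.rpow_mul (by linarith)]
    norm_num
  have hr2 : (n : ℝ) ^ ((2 : ℝ) / 3) = r ^ 2 := by
    rw [hr, ← Real.rpow_natCast, ← Real.rpow_mul (by linarith)]
    norm_num
  set N : ℕ := ⌈8 * r⌉₊ with hNdef
  have hN8 : 8 * r ≤ N := Nat.le_ceil _
  have hN9 : (N : ℝ) ≤ 9 * r := by
    have := Nat.ceil_lt_add_one (a := 8 * r) (by linarith)
    linarith
  have hN0 : (0 : ℝ) < N := by linarith
  have hN2 : 2 ≤ N := by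
    have : (2 : ℝ) ≤ N := by linarith
    exact_mod_cast this
  set δ : ℝ := 1 / N with hδdef
  have hδ : 0 < δ := by positivity
  have hδN : δ * N = 1 := by rw [hδdef]; field_simp
  have hδr : δ * r ≤ 1 / 8 := by nlinarith
  have hδr' : 1 / 9 ≤ δ * r := by nlinarith
  have hδ1 : δ ≤ 1 / 8 := by nlinarith
  have hcos : 1 - Real.cos (Real.pi / N) ≤ 5 * δ ^ 2 := by
    have h1 := Real.one_sub_sq_div_two_le_cos (x := Real.pi / N)
    have h2 : (Real.pi / N) ^ 2 = Real.pi ^ 2 * δ ^ 2 := by rw [hδdef]; ring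
    have h3 : Real.pi ^ 2 ≤ 10 := by nlinarith [Real.pi_lt_d2, Real.pi_pos]
    have h4 := mul_le_mul_of_nonneg_right h3 (sq_nonneg δ)
    linarith
  have hδn : δ * n = δ * r * r ^ 2 := by rw [← hr3]; ring
  have hcond : 15 / 16 * (δ * n * (1 - Real.cos (Real.pi / N))) ≤ 1 := by
    have h1 := mul_le_mul_of_nonneg_left hcos (by positivity : 0 ≤ δ * n)
    have h2 : δ * n * (5 * δ ^ 2) = 5 * (δ * r) ^ 3 := by rw [← hr3]; ring
    have h3 : (δ * r) ^ 3 ≤ (1 / 8) ^ 3 := pow_le_pow_left₀ (by positivity) hδr 3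
    linarith
  have hbound := RepeatedGame.two_world_bound σ hδ.le hN2 n hcond
  have hlarge : 2 * (1 / 40 * r ^ 2)
      < δ * n * (3 / 4 - 15 / 8 * (1 - Real.cos (Real.pi / N))) := by
    have h1 : (1 : ℝ) / 2 ≤ 3 / 4 - 15 / 8 * (1 - Real.cos (Real.pi / N)) := by nlinarith
    have h2 : 1 / 9 * r ^ 2 ≤ δ * n := by
      rw [hδn]
      exact mul_le_mul_of_nonneg_right hδr' (sq_nonneg r)
    have h3 := mul_le_mul h2 h1 (by norm_num) (by positivity)
    have h4 : 0 < r ^ 2 := by positivity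
    linarith
  obtain ⟨Z, hZ, k, hk⟩ := RepeatedGame.exists_noise σ hN2 (hlarge.trans_le hbound)
  refine ⟨RepeatedGame.lossSeq δ Z (RepeatedGame.pad fun i => ((k i : ℕ) : ℤ)),
    RepeatedGame.hasMemory_lossSeq _ _ _ _,
    RepeatedGame.hasRange_lossSeq hδ.le (by linarith) hZ _ _,
    RepeatedGame.hasDrift_lossSeq hδ.le (by linarith) hZ ?_ ?_ _ ?_, ?_⟩
  · intro i
    unfold RepeatedGame.pad
    split_ifs <;> simp
  · intro i
    unfold RepeatedGame.pad
    split_ifs with h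
    · have h1 : ((k ⟨i, h⟩ : ℕ) : ℝ) ≤ N := by exact_mod_cast Nat.le_of_lt_succ (k ⟨i, h⟩).isLt
      have h2 := mul_le_mul_of_nonneg_left h1 hδ.le
      push_cast
      linarith
    · simp
  · intro t ht
    refine Real.le_sqrt_of_sq_le ?_
    have := Real.log_nonneg (x := (t : ℝ)) (by exact_mod_cast ht)
    linarith
  · rw [show (((n + 1 : ℕ) : ℝ) - 1) = n by push_cast; ring, hr2]
    exact hk
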